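/- **Conventions.** $\mathcal M_+(0,1)$ is the set of Lebesgue measurable functions $f:(0,1)\to[0,\infty]$; functions are identified when they agree a.e.; $1/0=\infty$ and $0\cdot\infty=0$. For $f\in\mathcal M_+(0,1)$ let $f^*(t)=\inf\{s\in(0,\infty): |\{x\in(0,1): f(x)>s\}|\le t\}$, $t\in[0,1]$. A rearrangement-invariant (r.i.) function norm is a functional $\|\cdot\|:\mathcal M_+(0,1)\to[0,\infty]$ such that for all $f,g,f_j\in\mathcal M_+(0,1)$ and $\lambda\ge0$: $\|f\|=0$ iff $f=0$ a.e., $\|\lambda f\|=\lambda\|f\|$ and $\|f+g\|\le\|f\|+\|g\|$; $f\le g$ a.e. implies $\|f\|\le\|g\|$; $f_j\nearrow f$ a.e. implies $\|f_j\|\nearrow\|f\|$; $\|1\|<\infty$; $\int_0^1 f\le c\|f\|$ with a constant $c<\infty$ independent of $f$; and $\|f\|=\|g\|$ whenever $f^*=g^*$. An r.i. space $Z=Z(0,1)$ consists of the measurable $f:(0,1)\to[-\infty,\infty]$ with $\|f\|_Z:=\|\,|f|\,\|_Z<\infty$, where $\|\cdot\|_Z$ is an r.i. function norm. Its fundamental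 function is $\varphi_Z(t)=\|\chi_E\|_Z$, where $E\subset(0,1)$ is measurable with $|E|=t$, for $t\in[0,1]$. **Theorem 3.1 (fundamental function of an operator-induced space).** Let $I:[0,1]\to[0,\infty)$ be non-decreasing, and let $Y=Y(0,1)$ be an r.i. space that contains the function $t\mapsto\int_t^1\frac{ds}{I(s)}$, $t\in(0,1)$, and satisfies $$\lim_{t\to0^+}\varphi_Y(t)=0 \tag{3.1}$$ and, for some constant $K<\infty$, $$\int_0^t\ \sup_{\tau\in(s,1)}\frac{\varphi_Y(\tau)}{I(\tau)}\,ds\ \le\ K\,t\sup_{s\in(t,1)}\frac{\varphi_Y(\frac s2)}{s}\int_{s/2}^s\frac{d\tau}{I(\tau)}\qquad\text{for all } t\in(0,1). \tag{3.2}$$ Define $$\|f\|_X=\sup\left\{\left\|\int_\tau^1\frac{h(s)}{I(s)}\,ds\right\|_Y:\ h\in\mathcal M_+(0,1),\ h^*=f^*\right\},\qquad f\in\mathcal M_+(0,1),$$ where the norm in $Y$ is taken with respect to the variable $\tau\in(0,1)$. Then $\|\cdot\|_X$ is an r.i. function norm, so that $X=X(0,1)$ is an r.i. space, and there are constants $c,C\in(0,\infty)$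 such that for all $t\in(0,1)$ $$c\,t\sup_{s\in(t,1)}\frac{\varphi_Y(\frac s2)}{s}\int_{s/2}^s\frac{d\tau}{I(\tau)}\ \le\ \varphi_X(t)\ \le\ C\,t\sup_{s\in(t,1)}\frac{\varphi_Y(\frac s2)}{s}\int_{s/2}^s\frac{d\tau}{I(\tau)}.$$ -/

import Mathlib

open MeasureTheory Set Filter
open scoped ENNReal NNReal Topology

namespace RI

/-- Lebesgue measure on the interval `(0,1)`, as a measure on `ℝ`. Functions on `(0,1)` are written as
functions on `ℝ`, of which only the values on `(0,1)` matter; a Lebesgue measurable function on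
`(0,1)` is one that satisfies `AEMeasurable f leb`. So `𝓜₊(0,1)` consists of the
`f : ℝ → ℝ≥0∞` with `AEMeasurable f leb`. -/
noncomputable def leb : Measure ℝ := volume.restrict (Ioo (0 : ℝ) 1)

/-- The distribution function `f_*(s) = |{x ∈ (0,1) : f x > s}|`. -/
noncomputable def distribution (f : ℝ → ℝ≥0∞) (s : ℝ≥0∞) : ℝ≥0∞ := leb {x | s < f x}

/-- The non-increasing rearrangement `f^*(t) = inf {s ∈ (0,∞) : f_*(s) ≤ t}` of `f ∈ 𝓜₊(0,1)`
(the infimum of the empty set is `∞`). -/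
noncomputable def rearrangement (f : ℝ → ℝ≥0∞) (t : ℝ) : ℝ≥0∞ :=
  sInf {s : ℝ≥0∞ | 0 < s ∧ s < ∞ ∧ distribution f s ≤ ENNReal.ofReal t}

/-- `ρ` is a rearrangement-invariant function norm on `𝓜₊(0,1)`. -/
structure IsRINorm (ρ : (ℝ → ℝ≥0∞) → ℝ≥0∞) : Prop where
  eq_zero_iff : ∀ f, AEMeasurable f leb → (ρ f = 0 ↔ f =ᵐ[leb] 0)
  smul : ∀ f, AEMeasurable f leb → ∀ c : ℝ≥0, ρ (fun x => (c : ℝ≥0∞) * f x) = c * ρ f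
  add_le : ∀ f g, AEMeasurable f leb → AEMeasurable g leb →
    ρ (fun x => f x + g x) ≤ ρ f + ρ g
  mono : ∀ f g, AEMeasurable f leb → AEMeasurable g leb → f ≤ᵐ[leb] g → ρ f ≤ ρ g
  fatou : ∀ (F : ℕ → ℝ → ℝ≥0∞) (f : ℝ → ℝ≥0∞), (∀ j, AEMeasurable (F j) leb) →
    AEMeasurable f leb →
    (∀ᵐ x ∂leb, Monotone (fun j => F j x) ∧ Tendsto (fun j => F j x) atTop (𝓝 (f x))) →
    Monotone (fun j => ρ (F j)) ∧ Tendsto (fun j => ρ (F j)) atTop (𝓝 (ρ f))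
  one_lt_top : ρ (fun _ => 1) < ∞
  lintegral_le : ∃ c : ℝ≥0, ∀ f, AEMeasurable f leb → ∫⁻ x, f x ∂leb ≤ c * ρ f
  rearr : ∀ f g, AEMeasurable f leb → AEMeasurable g leb →
    (∀ t ∈ Icc (0 : ℝ) 1, rearrangement f t = rearrangement g t) → ρ f = ρ g

/-- The fundamental function `φ(t) = ρ(χ_E)`, `|E| = t`, for `t ∈ [0,1]`, with `E = (0,t)`;
for a rearrangement-invariant `ρ` the choice of `E` does not matter. -/
noncomputable def fundamental (ρ : (ℝ → ℝ≥0∞) → ℝ≥0∞) (t : ℝ) : ℝ≥0∞ :=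
  ρ ((Ioo (0 : ℝ) t).indicator (fun _ => 1))

/-- The function `τ ↦ ∫_τ^1 h(s) / I(s) ds`; here `1 / 0 = ∞` and `0 · ∞ = 0`. -/
noncomputable def copson (I : ℝ → ℝ≥0) (h : ℝ → ℝ≥0∞) (τ : ℝ) : ℝ≥0∞ :=
  ∫⁻ s in Ioo τ 1, h s / (I s : ℝ≥0∞)

/-- The functional `f ↦ sup_h ‖∫_τ^1 h(s) / I(s) ds‖_Y`, the supremum being over all
`h ∈ 𝓜₊(0,1)` with `h^* = f^*`. -/
noncomputable def inducedNorm (Y : (ℝ → ℝ≥0∞) → ℝ≥0∞) (I : ℝ → ℝ≥0) (f : ℝ → ℝ≥0∞) : ℝ≥0∞ :=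
  ⨆ (h : ℝ → ℝ≥0∞) (_ : AEMeasurable h leb)
    (_ : ∀ t ∈ Icc (0 : ℝ) 1, rearrangement h t = rearrangement f t), Y (copson I h)

/-- The function `t ↦ t · sup_{s ∈ (t,1)} (φ(s/2) / s) ∫_{s/2}^s dτ / I(τ)`. -/
noncomputable def profile (φ : ℝ → ℝ≥0∞) (I : ℝ → ℝ≥0) (t : ℝ) : ℝ≥0∞ :=
  ENNReal.ofReal t * ⨆ s ∈ Ioo t 1,
    φ (s / 2) / ENNReal.ofReal s * ∫⁻ τ in Ioo (s / 2) s, 1 / (I τ : ℝ≥0∞)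

end RI

/-!
The norm properties of `inducedNorm Y I`, and the two-sided bound for its fundamental function, are
independent of each other.

**The norm.** Functions have the same rearrangement exactly when they have the same law
(`rearrangement_eq_iff`). To compare suprema over different rearrangement classes, say for `f` and
`g ≥ f`, one wants to replace a function `h` distributed like `f` by a pair `(h, k)` distributed
like `(f, g)`. Such a `k` need not exist (if `h` is injective, then `k` is a function of `h`,
whereas `g` need not be a function of `f`), but it does exist when `h` has countable range: the fibres of
`h` are atomless, so each of them carries the law that `g` has on the corresponding fibre of `f`
(`exists_identDistrib_prodMk`). By the Fatou property it is enough to treat discretizations of `h`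
(`IsRINorm.copson_le_of_discretize`). With `g` replaced by a pair or by a sequence of functions the
same argument gives the triangle inequality and the Fatou property. The norm dominates the integral
because `1 / I` is bounded below: the Copson transforms of `f` and of its reflection `f (1 - ·)`
control the integral of `f` over the two halves of the interval.

**The lower bound.** For `t < s < 1` the indicator of `(s/2, s/2 + t/2)` has Copson transform at
least `∫_{s/2}^{s/2+t/2} 1 / I` on `(0, s/2)`, and this integral is at least `t/s` times `∫_{s/2}^s 1 / I`
since `1 / I` is non-increasing.

**The upper bound.** If `h` is distributed like the indicator of `(0,t)`, Minkowski's integral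
inequality (`IsRINorm.minkowski`) gives `‖∫_τ^1 h / I‖_Y ≤ ∫_0^1 h φ_Y / I`. Off the countably many
jumps of `I` the quotient `φ_Y / I` lies below the non-increasing function
`s ↦ sup_{(s,1)} φ_Y / I`, so the last integral is at most the integral of that function over
`(0,t)`, which is what the assumed inequality estimates.
-/

namespace RI
open ProbabilityTheory

/-! ### Transport of laws -/

lemma continuous_cdf (μ : Measure ℝ) [IsProbabilityMeasure μ] [NullSingletonClass μ] :
    Continuous (cdf μ) := by
  refine continuous_iff_continuousAt.2 fun x => ?_
  rw [(monotone_cdf μ).continuousAt_iff_leftLim_eq_rightLim, StieltjesFunction.rightLim_eq]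
  have h := (cdf μ).measure_singleton x
  rw [measure_cdf, measure_singleton, eq_comm, ENNReal.ofReal_eq_zero] at h
  exact le_antisymm ((monotone_cdf μ).leftLim_le le_rfl) (by linarith)

/-- The distribution function of an atomless law transforms that law into the uniform one. -/
lemma measure_cdf_le (μ : Measure ℝ) [IsProbabilityMeasure μ] [NullSingletonClass μ]
    {c : ℝ} (h0 : 0 ≤ c) (h1 : c ≤ 1) : μ {x | cdf μ x ≤ c} = ENNReal.ofReal c := by
  have hex : ∀ d, 0 < d → d < 1 → ∃ x, cdf μ x = d := fun d hd0 hd1 =>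
    mem_range_of_exists_le_of_exists_ge (continuous_cdf μ)
      ((tendsto_cdf_atBot μ).eventually (eventually_le_nhds hd0)).exists
      ((tendsto_cdf_atTop μ).eventually (eventually_ge_nhds hd1)).exists
  rcases h1.eq_or_lt with rfl | h1
  · simp [cdf_le_one]
  refine le_antisymm ?_ ?_
  · have : Tendsto ENNReal.ofReal (𝓝[>] c) (𝓝 (ENNReal.ofReal c)) :=
      ENNReal.continuous_ofReal.continuousAt.tendsto.mono_left nhdsWithin_le_nhds
    refine ge_of_tendsto this ?_
    filter_upwards [Ioo_mem_nhdsGT h1] with d hd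
    obtain ⟨x, rfl⟩ := hex d (h0.trans_lt hd.1) hd.2
    rw [ofReal_cdf]
    refine measure_mono fun y hy => ?_
    by_contra hxy
    exact absurd (monotone_cdf μ (not_le.1 hxy).le) (not_le.2 (lt_of_le_of_lt hy hd.1))
  · rcases h0.eq_or_lt with rfl | h0
    · simp
    obtain ⟨x, rfl⟩ := hex c h0 h1
    rw [ofReal_cdf]
    exact measure_mono fun y hy => monotone_cdf μ hy

lemma exists_measurable_map_eq_of_prob {E : Type*} [MeasurableSpace E] [StandardBorelSpace E]
    [Nonempty E] (μ : Measure ℝ) [IsProbabilityMeasure μ] [NullSingletonClass μ] (ν : Measure E)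
    [IsProbabilityMeasure ν] : ∃ k : ℝ → E, Measurable k ∧ μ.map k = ν := by
  obtain ⟨f, hf, hfν⟩ := ν.exists_measurable_map_eq
  let u : ℝ → unitInterval := fun x => ⟨cdf μ x, cdf_nonneg μ x, cdf_le_one μ x⟩
  have hu : Measurable u := (continuous_cdf μ).measurable.subtype_mk
  refine ⟨f ∘ u, hf.comp hu, ?_⟩
  rw [← Measure.map_map hf hu, ← hfν]
  congr 1
  have := Measure.isProbabilityMeasure_map (μ := μ) hu.aemeasurable
  refine Measure.ext_of_Iic _ _ fun c => ?_
  rw [Measure.map_apply hu measurableSet_Iic, unitInterval.volume_Iic]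
  exact measure_cdf_le μ c.2.1 c.2.2

/-- Any law on a standard Borel space is realised on an atomless finite measure of the same mass. -/
lemma exists_measurable_map_eq {E : Type*} [MeasurableSpace E] [StandardBorelSpace E]
    [Nonempty E] (μ : Measure ℝ) [IsFiniteMeasure μ] [NullSingletonClass μ] (ν : Measure E)
    (h : μ univ = ν univ) : ∃ k : ℝ → E, Measurable k ∧ μ.map k = ν := by
  by_cases h0 : μ univ = 0
  · refine ⟨fun _ => Classical.arbitrary E, measurable_const, ?_⟩
    have hμ : μ = 0 := Measure.measure_univ_eq_zero.1 h0
    have hν : ν = 0 := Measure.measure_univ_eq_zero.1 (h ▸ h0)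
    rw [hμ, hν, Measure.map_zero]
  have htop : μ univ ≠ ∞ := measure_ne_top _ _
  have : IsProbabilityMeasure ((μ univ)⁻¹ • μ) :=
    ⟨by simp [ENNReal.inv_mul_cancel h0 htop]⟩
  have : IsProbabilityMeasure ((μ univ)⁻¹ • ν) :=
    ⟨by simp [← h, ENNReal.inv_mul_cancel h0 htop]⟩
  have : NullSingletonClass ((μ univ)⁻¹ • μ) := ⟨fun x => by simp⟩
  obtain ⟨k, hk, hkν⟩ := exists_measurable_map_eq_of_prob ((μ univ)⁻¹ • μ) ((μ univ)⁻¹ • ν)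
  refine ⟨k, hk, ?_⟩
  have := congrArg (fun m => μ univ • m) hkν
  simpa [smul_smul, ENNReal.mul_inv_cancel h0 htop] using this

/-- Transfer of randomness for discrete data: if `h` and `f` are countably valued and
equidistributed, every function `G` accompanying `f` has a counterpart `k` accompanying `h` with the same joint
law. For non-discrete `h` this may fail, for lack of extra randomness. -/
lemma exists_identDistrib_prodMk {A E : Type*} [MeasurableSpace A] [Countable A]
    [MeasurableSingletonClass A] [MeasurableSpace E] [StandardBorelSpace E] [Nonempty E]
    {μ : Measure ℝ} [IsFiniteMeasure μ] [NullSingletonClass μ] {h f : ℝ → A} {G : ℝ → E}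
    (hf : IdentDistrib h f μ μ) (hG : AEMeasurable G μ) :
    ∃ k : ℝ → E, IdentDistrib (fun x => (h x, k x)) (fun x => (f x, G x)) μ μ := by
  wlog hm : Measurable h ∧ Measurable f ∧ Measurable G generalizing h f G
  · obtain ⟨k, hk⟩ := this (h := hf.aemeasurable_fst.mk) (f := hf.aemeasurable_snd.mk)
      (hf.aemeasurable_fst.identDistrib_mk.symm.trans
        (hf.trans hf.aemeasurable_snd.identDistrib_mk)) hG.measurable_mk.aemeasurable
      ⟨hf.aemeasurable_fst.measurable_mk, hf.aemeasurable_snd.measurable_mk, hG.measurable_mk⟩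
    refine ⟨k, ⟨hk.aemeasurable_fst.congr ?_, hf.aemeasurable_snd.prodMk hG, ?_⟩⟩
    · filter_upwards [hf.aemeasurable_fst.ae_eq_mk] with x hx
      rw [hx]
    · have h1 : (fun x => (h x, k x)) =ᵐ[μ] fun x => (hf.aemeasurable_fst.mk h x, k x) := by
        filter_upwards [hf.aemeasurable_fst.ae_eq_mk] with x hx
        rw [hx]
      have h2 : (fun x => (f x, G x)) =ᵐ[μ]
          fun x => (hf.aemeasurable_snd.mk f x, hG.mk G x) := by
        filter_upwards [hf.aemeasurable_snd.ae_eq_mk, hG.ae_eq_mk] with x hx hx'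
        rw [hx, hx']
      rw [Measure.map_congr h1, Measure.map_congr h2, hk.map_eq]
  obtain ⟨hhm, hfm, hGm⟩ := hm
  have key : ∀ a : A, ∃ k : ℝ → E, Measurable k ∧
      (μ.restrict (h ⁻¹' {a})).map k = (μ.restrict (f ⁻¹' {a})).map G := fun a => by
    refine exists_measurable_map_eq _ _ ?_
    rw [Measure.map_apply hGm MeasurableSet.univ]
    simpa using hf.measure_mem_eq (measurableSet_singleton a)
  choose k hk hkG using key
  have hkm : Measurable fun x => k (h x) x :=
    (measurable_from_prod_countable_right (f := fun p : A × ℝ => k p.1 p.2) hk).comp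
      (hhm.prodMk measurable_id)
  refine ⟨fun x => k (h x) x, (hhm.prodMk hkm).aemeasurable, (hfm.prodMk hGm).aemeasurable, ?_⟩
  ext S hS
  have hsec : ∀ a, MeasurableSet {e | (a, e) ∈ S} := fun a => measurable_prodMk_left hS
  have decomp : ∀ (g : ℝ → A) (l : A → ℝ → E), Measurable g → (∀ a, Measurable (l a)) →
      μ ((fun x => (g x, l (g x) x)) ⁻¹' S) =
        ∑' a, (μ.restrict (g ⁻¹' {a})).map (l a) {e | (a, e) ∈ S} := fun g l hg hl => by
    have : (fun x => (g x, l (g x) x)) ⁻¹' S =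
        ⋃ a, (l a ⁻¹' {e | (a, e) ∈ S}) ∩ g ⁻¹' {a} := by
      ext x; simp
    rw [this, measure_iUnion]
    · refine tsum_congr fun a => ?_
      rw [Measure.map_apply (hl a) (hsec a), Measure.restrict_apply (hl a (hsec a))]
    · intro a b hab
      refine Disjoint.mono inter_subset_right inter_subset_right ?_
      exact (disjoint_singleton.2 hab).preimage g
    · exact fun a => (hl a (hsec a)).inter (hg (measurableSet_singleton a))
  rw [Measure.map_apply (hhm.prodMk hkm) hS, Measure.map_apply (hfm.prodMk hGm) hS,
    decomp h k hhm hk, decomp f (fun _ => G) hfm fun _ => hGm]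
  simp_rw [hkG]

/-! ### Rearrangements and laws -/

instance : IsProbabilityMeasure leb := ⟨by simp [leb]⟩

instance : NullSingletonClass leb := by unfold leb; infer_instance

lemma ae_leb_mem : ∀ᵐ x ∂leb, x ∈ Ioo (0 : ℝ) 1 := ae_restrict_mem measurableSet_Ioo

lemma distribution_antitone (f : ℝ → ℝ≥0∞) : Antitone (distribution f) := fun _ _ hst =>
  measure_mono fun _ hx => lt_of_le_of_lt hst hx

lemma distribution_le_of_forall_lt {f : ℝ → ℝ≥0∞} {s c : ℝ≥0∞} (hs : s ≠ ∞)
    (h : ∀ r, s < r → distribution f r ≤ c) : distribution f s ≤ c := by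
  obtain ⟨u, hu, hsu, hlim⟩ := exists_seq_strictAnti_tendsto' (lt_top_iff_ne_top.2 hs)
  have hset : {x | s < f x} = ⋃ n, {x | u n < f x} := by
    ext x
    simp only [mem_ofPred_eq, mem_iUnion]
    exact ⟨fun hx => (hlim.eventually (eventually_lt_nhds hx)).exists,
      fun ⟨n, hn⟩ => (hsu n).1.trans hn⟩
  have hmono : Monotone fun n => {x | u n < f x} := fun m n hmn x hx =>
    lt_of_le_of_lt (hu.antitone hmn) hx
  rw [distribution, hset, hmono.measure_iUnion]
  exact iSup_le fun n => h _ (hsu n).1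

/-- The rearrangement is the generalised inverse of the distribution function. -/
lemma rearrangement_le_iff {f : ℝ → ℝ≥0∞} {s : ℝ≥0∞} (hs : s ≠ ∞) (t : ℝ) :
    rearrangement f t ≤ s ↔ distribution f s ≤ ENNReal.ofReal t := by
  constructor
  · refine fun h => distribution_le_of_forall_lt hs fun r hr => ?_
    obtain ⟨r', hr', hlt⟩ := sInf_lt_iff.1 (h.trans_lt hr)
    exact (distribution_antitone f hlt.le).trans hr'.2.2
  · refine fun h => le_of_forall_gt_imp_ge_of_dense fun r hr => ?_
    rcases eq_or_ne r ∞ with rfl | hr'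
    · exact le_top
    · exact sInf_le ⟨pos_of_gt hr, lt_top_iff_ne_top.2 hr',
        (distribution_antitone f hr.le).trans h⟩

lemma identDistrib_of_distribution_eq {h f : ℝ → ℝ≥0∞} (hh : AEMeasurable h leb)
    (hf : AEMeasurable f leb) (H : ∀ s, distribution h s = distribution f s) :
    IdentDistrib h f leb leb := by
  refine ⟨hh, hf, ?_⟩
  have := Measure.isProbabilityMeasure_map hh
  have := Measure.isProbabilityMeasure_map hf
  refine Measure.ext_of_Iic _ _ fun s => ?_
  rw [← compl_Ioi, prob_compl_eq_one_sub measurableSet_Ioi,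
    prob_compl_eq_one_sub measurableSet_Ioi, Measure.map_apply_of_aemeasurable hh measurableSet_Ioi,
    Measure.map_apply_of_aemeasurable hf measurableSet_Ioi]
  exact congrArg _ (H s)

lemma rearrangement_eq_iff {h f : ℝ → ℝ≥0∞} (hh : AEMeasurable h leb) (hf : AEMeasurable f leb) :
    (∀ t ∈ Icc (0 : ℝ) 1, rearrangement h t = rearrangement f t) ↔ IdentDistrib h f leb leb := by
  constructor
  · intro H
    have le : ∀ {g k : ℝ → ℝ≥0∞},
        (∀ t ∈ Icc (0 : ℝ) 1, rearrangement g t = rearrangement k t) → ∀ s,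
        distribution g s ≤ distribution k s := by
      intro g k H s
      rcases eq_or_ne s ∞ with rfl | hs
      · simp [distribution]
      have h1 : distribution k s ≤ 1 := prob_le_one
      have hfin : distribution k s ≠ ∞ := measure_ne_top _ _
      have hmem : (distribution k s).toReal ∈ Icc (0 : ℝ) 1 :=
        ⟨ENNReal.toReal_nonneg, ENNReal.toReal_le_of_le_ofReal zero_le_one (by simpa using h1)⟩
      have := (rearrangement_le_iff hs (distribution k s).toReal).2
        (by rw [ENNReal.ofReal_toReal hfin])
      rw [← H _ hmem, rearrangement_le_iff hs, ENNReal.ofReal_toReal hfin] at this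
      exact this
    exact identDistrib_of_distribution_eq hh hf fun s =>
      le_antisymm (le H s) (le (fun t ht => (H t ht).symm) s)
  · intro H t _
    have : distribution h = distribution f := funext fun s => H.measure_mem_eq measurableSet_Ioi
    simp only [rearrangement, this]

/-! ### The induced functional -/

section
variable {Y : (ℝ → ℝ≥0∞) → ℝ≥0∞} {I : ℝ → ℝ≥0}

lemma le_inducedNorm {h f : ℝ → ℝ≥0∞} (H : IdentDistrib h f leb leb) :
    Y (copson I h) ≤ inducedNorm Y I f :=
  le_iSup_of_le h <| le_iSup_of_le H.aemeasurable_fst <| le_iSup_of_le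
    ((rearrangement_eq_iff H.aemeasurable_fst H.aemeasurable_snd).2 H) le_rfl

lemma inducedNorm_le {f : ℝ → ℝ≥0∞} (hf : AEMeasurable f leb) {c : ℝ≥0∞}
    (H : ∀ h, IdentDistrib h f leb leb → Y (copson I h) ≤ c) : inducedNorm Y I f ≤ c :=
  iSup_le fun h => iSup_le fun hh => iSup_le fun hr => H h ((rearrangement_eq_iff hh hf).1 hr)

end

lemma measurable_copson (I : ℝ → ℝ≥0) (h : ℝ → ℝ≥0∞) : Measurable (copson I h) :=
  Antitone.measurable fun _ _ hst => lintegral_mono_set (Ioo_subset_Ioo_left hst)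

lemma restrict_Ioo_le_leb {a : ℝ} (ha : 0 ≤ a) {b : ℝ} (hb : b ≤ 1) :
    volume.restrict (Ioo a b) ≤ leb := Measure.restrict_mono (Ioo_subset_Ioo ha hb) le_rfl

lemma copson_mono {I : ℝ → ℝ≥0} {h k : ℝ → ℝ≥0∞} (hk : h ≤ᵐ[leb] k) {τ : ℝ} (hτ : 0 ≤ τ) :
    copson I h τ ≤ copson I k τ := by
  refine lintegral_mono_ae ?_
  filter_upwards [ae_mono (restrict_Ioo_le_leb hτ le_rfl) hk] with x hx
  gcongr

lemma aemeasurable_weight {I : ℝ → ℝ≥0} (hI : MonotoneOn I (Icc (0 : ℝ) 1)) :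
    AEMeasurable (fun s => (I s : ℝ≥0∞)) leb :=
  (aemeasurable_restrict_of_monotoneOn measurableSet_Ioo
    (hI.mono Ioo_subset_Icc_self)).coe_nnreal_ennreal

lemma copson_add {I : ℝ → ℝ≥0} (hI : MonotoneOn I (Icc (0 : ℝ) 1))
    {h k : ℝ → ℝ≥0∞} (hh : AEMeasurable h leb) {τ : ℝ} (hτ : 0 ≤ τ) :
    copson I (fun x => h x + k x) τ = copson I h τ + copson I k τ := by
  simp only [copson, ENNReal.add_div]
  exact lintegral_add_left' ((hh.div (aemeasurable_weight hI)).mono_measure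
    (restrict_Ioo_le_leb hτ le_rfl)) _

lemma tendsto_copson {I : ℝ → ℝ≥0} (hI : MonotoneOn I (Icc (0 : ℝ) 1))
    {F : ℕ → ℝ → ℝ≥0∞} {f : ℝ → ℝ≥0∞} (hF : ∀ j, AEMeasurable (F j) leb)
    (hlim : ∀ᵐ x ∂leb, Monotone (fun j => F j x) ∧ Tendsto (fun j => F j x) atTop (𝓝 (f x)))
    {τ : ℝ} (hτ : 0 ≤ τ) :
    Monotone (fun j => copson I (F j) τ) ∧
      Tendsto (fun j => copson I (F j) τ) atTop (𝓝 (copson I f τ)) := by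
  have hle := restrict_Ioo_le_leb hτ le_rfl
  constructor
  · refine fun i j hij => copson_mono ?_ hτ
    filter_upwards [hlim] with x hx using hx.1 hij
  · refine lintegral_tendsto_of_tendsto_of_monotone
      (fun j => ((hF j).div (aemeasurable_weight hI)).mono_measure hle) ?_ ?_
    · filter_upwards [ae_mono hle hlim] with x hx i j hij
      exact ENNReal.div_le_div_right (hx.1 hij) _
    · filter_upwards [ae_mono hle hlim] with x hx
      -- Suprema commute with division even where `1 / I = ∞`; limits do not.
      have : f x = ⨆ j, F j x := tendsto_nhds_unique hx.2 (tendsto_atTop_iSup hx.1)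
      rw [this, ENNReal.iSup_div]
      exact tendsto_atTop_iSup fun i j hij => ENNReal.div_le_div_right (hx.1 hij) _

section
variable {Y : (ℝ → ℝ≥0∞) → ℝ≥0∞} {I : ℝ → ℝ≥0}

/-! ### Function norms and the Copson operator -/

lemma IsRINorm.zero (hY : IsRINorm Y) : Y (fun _ => 0) = 0 :=
  (hY.eq_zero_iff _ aemeasurable_const).2 (ae_eq_refl _)

lemma IsRINorm.copson_mono (hY : IsRINorm Y) {h k : ℝ → ℝ≥0∞} (hk : h ≤ᵐ[leb] k) :
    Y (copson I h) ≤ Y (copson I k) :=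
  hY.mono _ _ (measurable_copson I h).aemeasurable (measurable_copson I k).aemeasurable <|
    ae_leb_mem.mono fun _ hτ => RI.copson_mono hk hτ.1.le

lemma IsRINorm.copson_add_le (hY : IsRINorm Y) (hI : MonotoneOn I (Icc (0 : ℝ) 1))
    {h k : ℝ → ℝ≥0∞} (hh : AEMeasurable h leb) :
    Y (copson I fun x => h x + k x) ≤ Y (copson I h) + Y (copson I k) := by
  have hm := fun l => (measurable_copson I l).aemeasurable (μ := leb)
  refine (hY.mono _ _ (hm _) ((hm h).add (hm k)) ?_).trans (hY.add_le _ _ (hm h) (hm k))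
  exact ae_leb_mem.mono fun τ hτ => (copson_add hI hh hτ.1.le).le

lemma IsRINorm.copson_const_mul (hY : IsRINorm Y) (c : ℝ≥0) (h : ℝ → ℝ≥0∞) :
    Y (copson I fun x => c * h x) = c * Y (copson I h) := by
  rw [← hY.smul _ (measurable_copson I h).aemeasurable]
  congr 1
  ext τ
  simp only [copson, mul_div_assoc]
  exact lintegral_const_mul' _ _ ENNReal.coe_ne_top

lemma IsRINorm.tendsto_copson (hY : IsRINorm Y) (hI : MonotoneOn I (Icc (0 : ℝ) 1))
    {F : ℕ → ℝ → ℝ≥0∞} {f : ℝ → ℝ≥0∞} (hF : ∀ j, AEMeasurable (F j) leb)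
    (hlim : ∀ᵐ x ∂leb, Monotone (fun j => F j x) ∧ Tendsto (fun j => F j x) atTop (𝓝 (f x))) :
    Tendsto (fun j => Y (copson I (F j))) atTop (𝓝 (Y (copson I f))) :=
  (hY.fatou _ _ (fun j => (measurable_copson I (F j)).aemeasurable)
    (measurable_copson I f).aemeasurable
    (ae_leb_mem.mono fun _ hτ => RI.tendsto_copson hI hF hlim hτ.1.le)).2

/-! ### Discretization -/

/-- Simple functions increasing to the identity of `[0,∞]`. Composing with `discretize n` turns
equidistributed functions into equidistributed functions of finite range. -/
noncomputable def discretize (n : ℕ) : SimpleFunc ℝ≥0∞ ℝ≥0∞ := SimpleFunc.eapprox id n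

lemma discretize_le (n : ℕ) (x : ℝ≥0∞) : discretize n x ≤ x :=
  (le_iSup (fun n => discretize n x) n).trans_eq (SimpleFunc.iSup_eapprox_apply measurable_id x)

lemma monotone_discretize (x : ℝ≥0∞) : Monotone fun n => discretize n x :=
  fun _ _ hmn => SimpleFunc.monotone_eapprox id hmn x

lemma tendsto_discretize (x : ℝ≥0∞) : Tendsto (fun n => discretize n x) atTop (𝓝 x) := by
  simpa only [discretize, SimpleFunc.iSup_eapprox_apply measurable_id x, id] using
    tendsto_atTop_iSup (monotone_discretize x)

lemma exists_identDistrib_discretize {E : Type*} [MeasurableSpace E] [StandardBorelSpace E]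
    [Nonempty E] {h f : ℝ → ℝ≥0∞} {G : ℝ → E} (H : IdentDistrib h f leb leb)
    (hG : AEMeasurable G leb) (n : ℕ) :
    ∃ k : ℝ → E, IdentDistrib (fun x => (discretize n (h x), k x))
      (fun x => (discretize n (f x), G x)) leb leb := by
  let e : ℝ≥0∞ → (discretize n).range := fun x => ⟨discretize n x, SimpleFunc.mem_range_self _ x⟩
  have he : Measurable e := (discretize n).measurable.subtype_mk
  obtain ⟨k, hk⟩ := exists_identDistrib_prodMk (H.comp he) hG
  exact ⟨k, hk.comp (u := fun p : (discretize n).range × E => ((p.1 : ℝ≥0∞), p.2))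
    ((measurable_subtype_coe.comp measurable_fst).prodMk measurable_snd)⟩

lemma IsRINorm.copson_le_of_discretize (hY : IsRINorm Y) (hI : MonotoneOn I (Icc (0 : ℝ) 1))
    {h : ℝ → ℝ≥0∞} (hh : AEMeasurable h leb) {c : ℝ≥0∞}
    (H : ∀ n, Y (copson I fun x => discretize n (h x)) ≤ c) : Y (copson I h) ≤ c :=
  le_of_tendsto' (hY.tendsto_copson hI
    (fun n => (discretize n).measurable.comp_aemeasurable hh)
    (ae_of_all _ fun _ => ⟨monotone_discretize _, tendsto_discretize _⟩)) H

/-! ### The induced functional is a rearrangement-invariant norm -/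

lemma inducedNorm_mono (hY : IsRINorm Y) (hI : MonotoneOn I (Icc (0 : ℝ) 1)) {f g : ℝ → ℝ≥0∞}
    (hf : AEMeasurable f leb) (hg : AEMeasurable g leb) (hfg : f ≤ᵐ[leb] g) :
    inducedNorm Y I f ≤ inducedNorm Y I g := by
  refine inducedNorm_le hf fun h H => hY.copson_le_of_discretize hI H.aemeasurable_fst fun n => ?_
  obtain ⟨k, hk⟩ := exists_identDistrib_discretize H hg n
  have hle : ∀ᵐ x ∂leb, discretize n (h x) ≤ k x :=
    hk.symm.ae_snd (p := fun p => p.1 ≤ p.2) (measurableSet_le measurable_fst measurable_snd)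
      (hfg.mono fun x hx => (discretize_le n _).trans hx)
  exact (hY.copson_mono hle).trans (le_inducedNorm (hk.comp measurable_snd))

lemma inducedNorm_add_le (hY : IsRINorm Y) (hI : MonotoneOn I (Icc (0 : ℝ) 1)) {f g : ℝ → ℝ≥0∞}
    (hf : AEMeasurable f leb) (hg : AEMeasurable g leb) :
    inducedNorm Y I (fun x => f x + g x) ≤ inducedNorm Y I f + inducedNorm Y I g := by
  refine inducedNorm_le (hf.add hg) fun h H =>
    hY.copson_le_of_discretize hI H.aemeasurable_fst fun n => ?_
  obtain ⟨k, hk⟩ := exists_identDistrib_discretize H (hf.prodMk hg) n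
  have hle : ∀ᵐ x ∂leb, discretize n (h x) ≤ (k x).1 + (k x).2 :=
    hk.symm.ae_snd (p := fun p => p.1 ≤ p.2.1 + p.2.2)
      (measurableSet_le measurable_fst (by fun_prop))
      (ae_of_all _ fun x => discretize_le n _)
  have h1 := hk.comp (u := fun p => p.2.1) (by fun_prop)
  have h2 := hk.comp (u := fun p => p.2.2) (by fun_prop)
  calc _ ≤ _ := hY.copson_mono hle
    _ ≤ _ := hY.copson_add_le hI h1.aemeasurable_fst
    _ ≤ _ := add_le_add (le_inducedNorm h1) (le_inducedNorm h2)

/-- The Fatou property: a discretization of a function distributed like `f` is dominated by the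
supremum of an increasing sequence `k j`, with `k j` distributed like `F j`. -/
lemma tendsto_inducedNorm (hY : IsRINorm Y) (hI : MonotoneOn I (Icc (0 : ℝ) 1))
    {F : ℕ → ℝ → ℝ≥0∞} {f : ℝ → ℝ≥0∞} (hF : ∀ j, AEMeasurable (F j) leb)
    (hf : AEMeasurable f leb)
    (hlim : ∀ᵐ x ∂leb, Monotone (fun j => F j x) ∧ Tendsto (fun j => F j x) atTop (𝓝 (f x))) :
    Monotone (fun j => inducedNorm Y I (F j)) ∧
      Tendsto (fun j => inducedNorm Y I (F j)) atTop (𝓝 (inducedNorm Y I f)) := by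
  have hmono : Monotone (fun j => inducedNorm Y I (F j)) := fun i j hij =>
    inducedNorm_mono hY hI (hF i) (hF j) (hlim.mono fun x hx => hx.1 hij)
  refine ⟨hmono, ?_⟩
  suffices inducedNorm Y I f = ⨆ j, inducedNorm Y I (F j) from
    this ▸ tendsto_atTop_iSup hmono
  refine le_antisymm (inducedNorm_le hf fun h H =>
    hY.copson_le_of_discretize hI H.aemeasurable_fst fun n => ?_)
    (iSup_le fun j => inducedNorm_mono hY hI (hF j) hf
      (hlim.mono fun x hx => hx.1.ge_of_tendsto hx.2 j))
  obtain ⟨k, hk⟩ := exists_identDistrib_discretize H (aemeasurable_pi_iff.2 hF :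
    AEMeasurable (fun x j => F j x) leb) n
  have hkj : ∀ j, IdentDistrib (fun x => k x j) (F j) leb leb := fun j =>
    hk.comp (u := fun p : ℝ≥0∞ × (ℕ → ℝ≥0∞) => p.2 j) (by fun_prop)
  have hle : ∀ᵐ x ∂leb, discretize n (h x) ≤ ⨆ j, k x j :=
    hk.symm.ae_snd (p := fun p => p.1 ≤ ⨆ j, p.2 j)
      (measurableSet_le measurable_fst (Measurable.iSup fun j => by fun_prop))
      (hlim.mono fun x hx => (discretize_le n _).trans
        (tendsto_nhds_unique hx.2 (tendsto_atTop_iSup hx.1)).le)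
  have hkmono : ∀ᵐ x ∂leb, ∀ j, k x j ≤ k x (j + 1) := ae_all_iff.2 fun j =>
    hk.symm.ae_snd (p := fun p => p.2 j ≤ p.2 (j + 1))
      (measurableSet_le (by fun_prop) (by fun_prop))
      (hlim.mono fun x hx => hx.1 j.le_succ)
  refine (hY.copson_mono hle).trans (le_of_tendsto' (hY.tendsto_copson hI
    (fun j => (hkj j).aemeasurable_fst) ?_) fun j => (le_inducedNorm (hkj j)).trans
      (le_iSup (fun j => inducedNorm Y I (F j)) j))
  filter_upwards [hkmono] with x hx
  exact ⟨monotone_nat_of_le_succ hx, tendsto_atTop_iSup (monotone_nat_of_le_succ hx)⟩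

lemma ae_eq_const_of_identDistrib {h f : ℝ → ℝ≥0∞} {c : ℝ≥0∞} (H : IdentDistrib h f leb leb)
    (hf : f =ᵐ[leb] fun _ => c) : h =ᵐ[leb] fun _ => c :=
  H.symm.ae_snd (p := fun y => y = c) (measurableSet_singleton c) hf

lemma inducedNorm_eq_zero (hY : IsRINorm Y) {f : ℝ → ℝ≥0∞} (hf : AEMeasurable f leb)
    (h0 : f =ᵐ[leb] 0) : inducedNorm Y I f = 0 := by
  refine le_antisymm (inducedNorm_le hf fun h H => ?_) zero_le
  refine (hY.copson_mono (ae_eq_const_of_identDistrib (c := 0) H h0).le).trans_eq ?_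
  have : copson I (fun _ => 0) = fun _ => 0 := by ext; simp [copson]
  rw [this, hY.zero]

lemma inducedNorm_const_mul_le (hY : IsRINorm Y) {f : ℝ → ℝ≥0∞} (hf : AEMeasurable f leb)
    {c : ℝ≥0} (hc : c ≠ 0) : inducedNorm Y I (fun x => c * f x) ≤ c * inducedNorm Y I f := by
  refine inducedNorm_le (hf.const_mul _) fun h H => ?_
  have hinv : ∀ y : ℝ≥0∞, (c : ℝ≥0∞) * ((c⁻¹ : ℝ≥0) * y) = y ∧
      ((c⁻¹ : ℝ≥0) : ℝ≥0∞) * (c * y) = y := fun y => by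
    rw [← mul_assoc, ← mul_assoc, ← ENNReal.coe_mul, ← ENNReal.coe_mul, mul_inv_cancel₀ hc,
      inv_mul_cancel₀ hc]
    simp
  have H' := H.comp (u := fun y => ((c⁻¹ : ℝ≥0) : ℝ≥0∞) * y) (by fun_prop)
  have e1 : (fun y => ((c⁻¹ : ℝ≥0) : ℝ≥0∞) * y) ∘ (fun x => (c : ℝ≥0∞) * f x) = f :=
    funext fun x => (hinv _).2
  have e2 : h = fun x => (c : ℝ≥0∞) * (((c⁻¹ : ℝ≥0) : ℝ≥0∞) * h x) :=
    funext fun x => (hinv _).1.symm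
  rw [e1] at H'
  rw [e2, hY.copson_const_mul]
  gcongr
  exact le_inducedNorm H'

lemma inducedNorm_const_mul (hY : IsRINorm Y) {f : ℝ → ℝ≥0∞} (hf : AEMeasurable f leb)
    (c : ℝ≥0) : inducedNorm Y I (fun x => c * f x) = c * inducedNorm Y I f := by
  rcases eq_or_ne c 0 with rfl | hc
  · simpa using inducedNorm_eq_zero hY aemeasurable_const (ae_eq_refl _)
  refine le_antisymm (inducedNorm_const_mul_le hY hf hc) ?_
  have := inducedNorm_const_mul_le (I := I) hY (hf.const_mul (c : ℝ≥0∞)) (inv_ne_zero hc)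
  simp only [← mul_assoc, ← ENNReal.coe_mul, inv_mul_cancel₀ hc, ENNReal.coe_one, one_mul] at this
  calc _ ≤ (c : ℝ≥0∞) * (((c⁻¹ : ℝ≥0) : ℝ≥0∞) * inducedNorm Y I (fun x => c * f x)) := by gcongr
    _ = _ := by rw [← mul_assoc, ← ENNReal.coe_mul, mul_inv_cancel₀ hc, ENNReal.coe_one, one_mul]

lemma identDistrib_comp_one_sub {f : ℝ → ℝ≥0∞} (hf : AEMeasurable f leb) :
    IdentDistrib (fun x => f (1 - x)) f leb leb := by
  have hmp : MeasurePreserving (fun x : ℝ => 1 - x) leb leb := by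
    have := (Measure.measurePreserving_sub_left volume (1 : ℝ)).restrict_preimage
      (measurableSet_Ioo (a := (0 : ℝ)) (b := 1))
    simpa [leb] using this
  refine ⟨hf.comp_quasiMeasurePreserving hmp.quasiMeasurePreserving, hf, ?_⟩
  have := AEMeasurable.map_map_of_aemeasurable (hmp.map_eq.symm ▸ hf) hmp.measurable.aemeasurable
  rw [hmp.map_eq] at this
  exact this.symm

/-- A norm dominating the integral controls the integral of `f` over the right half of the interval
by the norm of the Copson transform, which is at least `∫_{1/2}^1 f / I` on the left half. -/
lemma IsRINorm.exists_lintegral_right_half_le (hY : IsRINorm Y)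
    (hI : MonotoneOn I (Icc (0 : ℝ) 1)) :
    ∃ C : ℝ≥0, ∀ f : ℝ → ℝ≥0∞, ∫⁻ x in Ioo (1 / 2 : ℝ) 1, f x ≤ C * Y (copson I f) := by
  obtain ⟨c, hc⟩ := hY.lintegral_le
  -- `I 1 + 1` bounds `I` on `(0,1)` and, unlike `I 1`, cannot vanish.
  refine ⟨(I 1 + 1) * (2 * c), fun f => ?_⟩
  have hM : ((I 1 + 1 : ℝ≥0) : ℝ≥0∞) ≠ 0 := by simp
  have h1 : ∫⁻ x in Ioo (1 / 2 : ℝ) 1, f x ≤ (I 1 + 1 : ℝ≥0) * copson I f (1 / 2) := by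
    rw [copson, ← lintegral_const_mul' _ _ ENNReal.coe_ne_top]
    refine setLIntegral_mono_ae' measurableSet_Ioo (ae_of_all _ fun x hx => ?_)
    have hIx : I x ≤ I 1 + 1 := (hI ⟨by linarith [hx.1], hx.2.le⟩ ⟨zero_le_one, le_rfl⟩
      hx.2.le).trans (by simp)
    calc f x = (I 1 + 1 : ℝ≥0) * (f x / (I 1 + 1 : ℝ≥0)) :=
          (ENNReal.mul_div_cancel hM ENNReal.coe_ne_top).symm
      _ ≤ _ := by gcongr
  have h2 : copson I f (1 / 2) ≤ 2 * ∫⁻ τ, copson I f τ ∂leb := by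
    have hhalf : copson I f (1 / 2) * ENNReal.ofReal (1 / 2) ≤ ∫⁻ τ, copson I f τ ∂leb :=
      calc copson I f (1 / 2) * ENNReal.ofReal (1 / 2)
          = ∫⁻ _ in Ioo (0 : ℝ) (1 / 2), copson I f (1 / 2) := by
            rw [setLIntegral_const, Real.volume_Ioo, sub_zero]
        _ ≤ ∫⁻ τ in Ioo (0 : ℝ) (1 / 2), copson I f τ :=
            setLIntegral_mono_ae' measurableSet_Ioo (ae_of_all _ fun τ hτ =>
              lintegral_mono_set (Ioo_subset_Ioo_left hτ.2.le))
        _ ≤ _ := lintegral_mono_set (Ioo_subset_Ioo_right (by norm_num))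
    calc copson I f (1 / 2) = 2 * (copson I f (1 / 2) * ENNReal.ofReal (1 / 2)) := by
          rw [mul_left_comm, ← ENNReal.ofReal_ofNat 2, ← ENNReal.ofReal_mul (by norm_num)]
          norm_num
      _ ≤ _ := by gcongr
  calc _ ≤ _ := h1
    _ ≤ (I 1 + 1 : ℝ≥0) * (2 * (c * Y (copson I f))) := by
        gcongr
        exact h2.trans (by gcongr; exact hc _ (measurable_copson I f).aemeasurable)
    _ = _ := by push_cast; ring

/-- The functions `f` and `f (1 - ·)` are equidistributed, and the integral of `f` over the left half
of the interval is that of `f (1 - ·)` over the right half. -/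
lemma exists_lintegral_le_inducedNorm (hY : IsRINorm Y) (hI : MonotoneOn I (Icc (0 : ℝ) 1)) :
    ∃ C : ℝ≥0, ∀ f, AEMeasurable f leb → ∫⁻ x, f x ∂leb ≤ C * inducedNorm Y I f := by
  obtain ⟨C, hC⟩ := hY.exists_lintegral_right_half_le hI
  refine ⟨2 * C, fun f hf => ?_⟩
  have hl : ∫⁻ x in Ioo (0 : ℝ) (1 / 2), f x = ∫⁻ x in Ioo (1 / 2 : ℝ) 1, f (1 - x) := by
    have hmp := (Measure.measurePreserving_sub_left volume (1 : ℝ))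
    have he : MeasurableEmbedding (fun x : ℝ => 1 - x) :=
      (MeasurableEquiv.subLeft 1).measurableEmbedding
    rw [← hmp.setLIntegral_comp_preimage_emb he f (Ioo (0 : ℝ) (1 / 2))]
    norm_num
  have hsplit : ∫⁻ x, f x ∂leb =
      (∫⁻ x in Ioo (0 : ℝ) (1 / 2), f x) + ∫⁻ x in Ioo (1 / 2 : ℝ) 1, f x := by
    have h : Ioo (0 : ℝ) 1 =ᵐ[volume] (Ioo (0 : ℝ) (1 / 2) ∪ Ioo (1 / 2 : ℝ) 1 : Set ℝ) := by
      have h1 : Ioo (0 : ℝ) (1 / 2) ∪ Ico (1 / 2 : ℝ) 1 = Ioo 0 1 :=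
        Ioo_union_Ico_eq_Ioo (by norm_num) (by norm_num)
      rw [← h1]
      exact (ae_eq_refl _).union Ioo_ae_eq_Ico.symm
    rw [leb, setLIntegral_congr h, lintegral_union measurableSet_Ioo]
    exact disjoint_left.2 fun x hx hx' => lt_asymm hx.2 hx'.1
  calc ∫⁻ x, f x ∂leb ≤ C * inducedNorm Y I f + C * inducedNorm Y I f := by
        rw [hsplit, hl]
        refine add_le_add ((hC _).trans ?_) ((hC _).trans ?_)
        · gcongr
          exact le_inducedNorm (identDistrib_comp_one_sub hf)
        · gcongr
          exact le_inducedNorm (.refl hf)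
    _ = _ := by push_cast; ring

theorem isRINorm_inducedNorm (hY : IsRINorm Y) (hI : MonotoneOn I (Icc (0 : ℝ) 1))
    (hIY : Y (copson I fun _ => 1) < ∞) : IsRINorm (inducedNorm Y I) where
  eq_zero_iff f hf := by
    refine ⟨fun h => ?_, inducedNorm_eq_zero hY hf⟩
    obtain ⟨C, hC⟩ := exists_lintegral_le_inducedNorm hY hI
    have := hC f hf
    rw [h, mul_zero] at this
    exact (lintegral_eq_zero_iff' hf).1 (le_antisymm this zero_le)
  smul f hf c := inducedNorm_const_mul hY hf c
  add_le f g hf hg := inducedNorm_add_le hY hI hf hg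
  mono f g hf hg hfg := inducedNorm_mono hY hI hf hg hfg
  fatou F f hF hf hlim := tendsto_inducedNorm hY hI hF hf hlim
  one_lt_top := (inducedNorm_le aemeasurable_const fun h H =>
    hY.copson_mono (ae_eq_const_of_identDistrib H (ae_eq_refl _)).le).trans_lt hIY
  lintegral_le := exists_lintegral_le_inducedNorm hY hI
  rearr f g hf hg hfg := by
    simp only [inducedNorm]
    refine iSup_congr fun h => iSup_congr fun _ => iSup_congr_Prop ?_ fun _ => rfl
    exact forall₂_congr fun t ht => by rw [hfg t ht]

/-! ### Scalars, finite sums and fundamental functions -/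

/-- Homogeneity for scalars in `[0,∞]`; the scalar `∞` is reached by the Fatou property. -/
lemma IsRINorm.const_mul (hY : IsRINorm Y) {f : ℝ → ℝ≥0∞} (hf : AEMeasurable f leb) (c : ℝ≥0∞) :
    Y (fun x => c * f x) = c * Y f := by
  rcases eq_or_ne c ∞ with rfl | hc
  · have htop : ∀ y : ℝ≥0∞, Monotone (fun n : ℕ => ((n : ℝ≥0) : ℝ≥0∞) * y) ∧
        Tendsto (fun n : ℕ => ((n : ℝ≥0) : ℝ≥0∞) * y) atTop (𝓝 (∞ * y)) := fun y => by
      have hm : Monotone (fun n : ℕ => ((n : ℝ≥0) : ℝ≥0∞) * y) := fun m n hmn => by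
        dsimp only; gcongr
      refine ⟨hm, ?_⟩
      have := tendsto_atTop_iSup hm
      rwa [← ENNReal.iSup_mul, show (⨆ n : ℕ, ((n : ℝ≥0) : ℝ≥0∞)) = ∞ by
        simpa using ENNReal.iSup_natCast] at this
    have h1 := (hY.fatou (fun (n : ℕ) x => ((n : ℝ≥0) : ℝ≥0∞) * f x) (fun x => ∞ * f x)
      (fun n => hf.const_mul _) (hf.const_mul _) (ae_of_all _ fun x => htop (f x))).2
    simp only [hY.smul f hf] at h1
    exact tendsto_nhds_unique h1 (htop (Y f)).2
  · lift c to ℝ≥0 using hc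
    exact hY.smul f hf c

lemma IsRINorm.finset_sum_le (hY : IsRINorm Y) {ι : Type*} (s : Finset ι) {f : ι → ℝ → ℝ≥0∞}
    (hf : ∀ i, AEMeasurable (f i) leb) :
    Y (fun x => ∑ i ∈ s, f i x) ≤ ∑ i ∈ s, Y (f i) := by
  classical
  induction s using Finset.induction_on with
  | empty => simpa using hY.zero.le
  | insert i s hi ih =>
    simp only [Finset.sum_insert hi]
    exact (hY.add_le _ _ (hf i) (Finset.aemeasurable_fun_sum s fun j _ => hf j)).trans
      (add_le_add_right ih _)

lemma aemeasurable_indicator_Ioo (a b : ℝ) :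
    AEMeasurable ((Ioo a b).indicator fun _ => (1 : ℝ≥0∞)) leb :=
  (measurable_const.indicator measurableSet_Ioo).aemeasurable

lemma IsRINorm.fundamental_mono (hY : IsRINorm Y) : Monotone (fundamental Y) := fun _ _ hst =>
  hY.mono _ _ (aemeasurable_indicator_Ioo _ _) (aemeasurable_indicator_Ioo _ _) <|
    ae_of_all _ <| indicator_le_indicator_of_subset (Ioo_subset_Ioo_right hst) (fun _ => zero_le)

lemma identDistrib_indicator {A B : Set ℝ} (hA : MeasurableSet A) (hB : MeasurableSet B)
    (h : leb A = leb B) :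
    IdentDistrib (A.indicator fun _ => (1 : ℝ≥0∞)) (B.indicator fun _ => 1) leb leb := by
  refine identDistrib_of_distribution_eq (measurable_const.indicator hA).aemeasurable
    (measurable_const.indicator hB).aemeasurable fun s => ?_
  have key : ∀ S : Set ℝ, {x | s < S.indicator (fun _ => (1 : ℝ≥0∞)) x} =
      if s < 1 then S else ∅ := fun S => by
    ext x
    by_cases hx : x ∈ S <;> by_cases hs : s < 1 <;> simp [hx, hs]
  simp only [distribution, key]
  split_ifs <;> simp [h]

/-! ### The lower bound -/

/-- Initial averages of a non-increasing function dominate its full averages. -/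
lemma mul_lintegral_le_of_antitoneOn {g : ℝ → ℝ≥0∞} {a m l : ℝ} (hm : 0 < m) (hml : m < l)
    (hg : AntitoneOn g (Ioo a (a + l))) :
    ENNReal.ofReal m * ∫⁻ x in Ioo a (a + l), g x ≤
      ENNReal.ofReal l * ∫⁻ x in Ioo a (a + m), g x := by
  have hmem : a + m ∈ Ioo a (a + l) := ⟨by linarith, by linarith⟩
  have h1 : ENNReal.ofReal m * g (a + m) ≤ ∫⁻ x in Ioo a (a + m), g x := by
    calc _ = ∫⁻ _ in Ioo a (a + m), g (a + m) := by
          rw [setLIntegral_const, Real.volume_Ioo, add_sub_cancel_left, mul_comm]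
      _ ≤ _ := setLIntegral_mono_ae' measurableSet_Ioo (ae_of_all _ fun x hx =>
          hg ⟨hx.1, by linarith [hx.2]⟩ hmem hx.2.le)
  have h2 : ∫⁻ x in Ico (a + m) (a + l), g x ≤ ENNReal.ofReal (l - m) * g (a + m) := by
    calc _ ≤ ∫⁻ _ in Ico (a + m) (a + l), g (a + m) :=
          setLIntegral_mono_ae' measurableSet_Ico (ae_of_all _ fun x hx =>
            hg hmem ⟨by linarith [hx.1], hx.2⟩ hx.1)
      _ = _ := by rw [setLIntegral_const, Real.volume_Ico, add_sub_add_left_eq_sub, mul_comm]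
  have hsplit : ∫⁻ x in Ioo a (a + l), g x =
      (∫⁻ x in Ioo a (a + m), g x) + ∫⁻ x in Ico (a + m) (a + l), g x := by
    rw [← Ioo_union_Ico_eq_Ioo hmem.1 hmem.2.le, lintegral_union measurableSet_Ico]
    exact disjoint_left.2 fun x hx hx' => absurd hx.2 (not_lt.2 hx'.1)
  calc _ ≤ ENNReal.ofReal m * (∫⁻ x in Ioo a (a + m), g x) +
        ENNReal.ofReal m * (ENNReal.ofReal (l - m) * g (a + m)) := by
        rw [hsplit, mul_add]; gcongr
    _ = ENNReal.ofReal m * (∫⁻ x in Ioo a (a + m), g x) +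
        ENNReal.ofReal (l - m) * (ENNReal.ofReal m * g (a + m)) := by ring
    _ ≤ ENNReal.ofReal m * (∫⁻ x in Ioo a (a + m), g x) +
        ENNReal.ofReal (l - m) * ∫⁻ x in Ioo a (a + m), g x := by gcongr
    _ = _ := by
        rw [← add_mul, ← ENNReal.ofReal_add hm.le (by linarith), add_sub_cancel]

lemma antitoneOn_one_div_weight (hI : MonotoneOn I (Icc (0 : ℝ) 1)) :
    AntitoneOn (fun s => 1 / (I s : ℝ≥0∞)) (Icc (0 : ℝ) 1) := fun x hx y hy hxy =>
  ENNReal.div_le_div_left (by exact_mod_cast hI hx hy hxy) 1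

/-- On `(0, a)` the Copson transform of `χ_{(a,b)}` is at least `∫_a^b 1 / I`. -/
lemma IsRINorm.fundamental_mul_le (hY : IsRINorm Y) {a b : ℝ} (hb : b ≤ 1) :
    fundamental Y a * ∫⁻ x in Ioo a b, 1 / (I x : ℝ≥0∞) ≤
      Y (copson I ((Ioo a b).indicator fun _ => 1)) := by
  rw [mul_comm, fundamental, ← hY.const_mul (aemeasurable_indicator_Ioo _ _)]
  refine hY.mono _ _ ((aemeasurable_indicator_Ioo _ _).const_mul _)
    (measurable_copson I _).aemeasurable (ae_of_all _ fun τ => ?_)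
  by_cases hτ : τ ∈ Ioo 0 a
  · simp only [indicator_of_mem hτ, mul_one, copson]
    calc _ = ∫⁻ x in Ioo a b, (Ioo a b).indicator (fun _ => 1) x / (I x : ℝ≥0∞) :=
          setLIntegral_congr_fun measurableSet_Ioo fun x hx => by
            simp only [indicator_of_mem hx]
      _ ≤ _ := lintegral_mono_set (Ioo_subset_Ioo hτ.2.le hb)
  · simp only [indicator_of_notMem hτ, mul_zero]
    exact zero_le

lemma profile_le_fundamental (hY : IsRINorm Y) (hI : MonotoneOn I (Icc (0 : ℝ) 1)) {t : ℝ}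
    (ht : t ∈ Ioo (0 : ℝ) 1) :
    profile (fundamental Y) I t ≤ fundamental (inducedNorm Y I) t := by
  simp only [profile, ENNReal.mul_iSup]
  refine iSup₂_le fun s hs => ?_
  have hs0 : 0 < s := ht.1.trans hs.1
  -- The test set `(s/2, s/2 + t/2)` stays inside `(s/2, s)` for every `t < s`.
  set J := ∫⁻ x in Ioo (s / 2) (s / 2 + t / 2), 1 / (I x : ℝ≥0∞)
  have havg : ENNReal.ofReal t * ∫⁻ x in Ioo (s / 2) s, 1 / (I x : ℝ≥0∞) ≤
      ENNReal.ofReal s * J := by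
    have h := mul_lintegral_le_of_antitoneOn (g := fun s => 1 / (I s : ℝ≥0∞)) (a := s / 2)
      (m := t / 2) (l := s / 2) (by linarith [ht.1]) (by linarith [hs.1])
      ((antitoneOn_one_div_weight hI).mono fun x hx =>
        ⟨by linarith [hx.1], by linarith [hx.2, hs.2]⟩)
    rw [add_halves] at h
    have h' := mul_le_mul_right h (2 : ℝ≥0∞)
    have h2 : ∀ r : ℝ, ENNReal.ofReal r = 2 * ENNReal.ofReal (r / 2) := fun r => by
      rw [← ENNReal.ofReal_ofNat 2, ← ENNReal.ofReal_mul (by norm_num),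
        mul_div_cancel₀ r two_ne_zero]
    rw [h2 t, h2 s, mul_assoc, mul_assoc]
    exact h'
  have hid : IdentDistrib ((Ioo (s / 2) (s / 2 + t / 2)).indicator fun _ => (1 : ℝ≥0∞))
      ((Ioo 0 (t / 2)).indicator fun _ => 1) leb leb := by
    refine identDistrib_indicator measurableSet_Ioo measurableSet_Ioo ?_
    rw [leb, Measure.restrict_apply measurableSet_Ioo, Measure.restrict_apply measurableSet_Ioo,
      inter_eq_left.2 (Ioo_subset_Ioo (by linarith) (by linarith [hs.1, hs.2])),
      inter_eq_left.2 (Ioo_subset_Ioo le_rfl (by linarith [ht.2]))]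
    simp
  calc ENNReal.ofReal t * (fundamental Y (s / 2) / ENNReal.ofReal s *
        ∫⁻ x in Ioo (s / 2) s, 1 / (I x : ℝ≥0∞))
      = fundamental Y (s / 2) / ENNReal.ofReal s *
        (ENNReal.ofReal t * ∫⁻ x in Ioo (s / 2) s, 1 / (I x : ℝ≥0∞)) := by ring
    _ ≤ fundamental Y (s / 2) / ENNReal.ofReal s * (ENNReal.ofReal s * J) := by gcongr
    _ = fundamental Y (s / 2) * J := by
        rw [← mul_assoc, ENNReal.div_mul_cancel (by simpa using hs0) ENNReal.ofReal_ne_top]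
    _ ≤ _ := hY.fundamental_mul_le (by linarith [hs.1, hs.2])
    _ ≤ _ := le_inducedNorm hid
    _ ≤ _ := inducedNorm_mono hY hI (aemeasurable_indicator_Ioo _ _)
        (aemeasurable_indicator_Ioo _ _) (ae_of_all _ <| indicator_le_indicator_of_subset
          (Ioo_subset_Ioo_right (by linarith [ht.1])) fun _ => zero_le)

/-! ### The upper bound -/

/-- `s` rounded down to a multiple of `2⁻ⁿ`. -/
noncomputable def dyadicFloor (n : ℕ) (s : ℝ) : ℝ := (⌊2 ^ n * s⌋₊ : ℝ) / 2 ^ n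

lemma dyadicFloor_le (n : ℕ) {s : ℝ} (hs : 0 ≤ s) : dyadicFloor n s ≤ s := by
  rw [dyadicFloor, div_le_iff₀ (by positivity), mul_comm]
  exact Nat.floor_le (by positivity)

lemma monotone_dyadicFloor {s : ℝ} (hs : 0 ≤ s) : Monotone fun n => dyadicFloor n s := by
  refine monotone_nat_of_le_succ fun n => ?_
  rw [dyadicFloor, dyadicFloor, div_le_div_iff₀ (by positivity) (by positivity), pow_succ']
  have h : ⌊2 ^ n * s⌋₊ * 2 ≤ ⌊2 * 2 ^ n * s⌋₊ := by
    refine Nat.le_floor ?_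
    push_cast
    have := Nat.floor_le (show 0 ≤ 2 ^ n * s by positivity)
    linarith
  have h' : (⌊2 ^ n * s⌋₊ : ℝ) * 2 ≤ ⌊2 * 2 ^ n * s⌋₊ := by exact_mod_cast h
  have := mul_le_mul_of_nonneg_right h' (show (0 : ℝ) ≤ 2 ^ n by positivity)
  linarith

lemma eventually_lt_dyadicFloor {τ s : ℝ} (h : τ < s) : ∀ᶠ n in atTop, τ < dyadicFloor n s := by
  have hlim : Tendsto (fun n : ℕ => (1 / 2 : ℝ) ^ n) atTop (𝓝 0) :=
    tendsto_pow_atTop_nhds_zero_of_lt_one (by norm_num) (by norm_num)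
  filter_upwards [hlim.eventually (eventually_lt_nhds (sub_pos.2 h))] with n hn
  rw [dyadicFloor, lt_div_iff₀ (by positivity)]
  have h1 := Nat.lt_floor_add_one (2 ^ n * s)
  have h2 : (1 / 2 : ℝ) ^ n * 2 ^ n = 1 := by rw [← mul_pow]; norm_num
  have h3 := mul_lt_mul_of_pos_right hn (show (0 : ℝ) < 2 ^ n by positivity)
  nlinarith

lemma measurable_dyadicFloor (n : ℕ) : Measurable (dyadicFloor n) := by
  unfold dyadicFloor
  fun_prop

/-- Minkowski's integral inequality for `τ ↦ ∫ χ_{(0,s)}(τ) w(s) ds`. -/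
lemma IsRINorm.minkowski (hY : IsRINorm Y) {w : ℝ → ℝ≥0∞} (hw : AEMeasurable w leb) :
    Y (fun τ => ∫⁻ s in Ioo τ 1, w s) ≤ ∫⁻ s, fundamental Y s * w s ∂leb := by
  let g : ℕ → ℝ → ℝ≥0∞ := fun n τ => ∫⁻ s, {s | τ < dyadicFloor n s}.indicator w s ∂leb
  have hmeas : ∀ n τ, MeasurableSet {s | τ < dyadicFloor n s} := fun n τ =>
    measurableSet_lt measurable_const (measurable_dyadicFloor n)
  have hg : ∀ n, Measurable (g n) := fun n => Antitone.measurable fun τ τ' hττ =>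
    lintegral_mono <| indicator_le_indicator_of_subset
      (fun s (hs : τ' < _) => lt_of_le_of_lt hττ hs) fun _ => zero_le
  have hlim : ∀ τ ∈ Ioo (0 : ℝ) 1, Monotone (fun n => g n τ) ∧
      Tendsto (fun n => g n τ) atTop (𝓝 (∫⁻ s in Ioo τ 1, w s)) := fun τ hτ => by
    have hmono : ∀ᵐ s ∂leb, Monotone fun n => {s | τ < dyadicFloor n s}.indicator w s := by
      filter_upwards [ae_leb_mem] with s hs m n hmn
      by_cases hm : s ∈ {s | τ < dyadicFloor m s}
      · have hn : s ∈ {s | τ < dyadicFloor n s} :=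
          lt_of_lt_of_le hm (monotone_dyadicFloor hs.1.le hmn)
        simp only [indicator_of_mem hm, indicator_of_mem hn, le_refl]
      · simp only [indicator_of_notMem hm, zero_le]
    have hset : ∫⁻ s in Ioo τ 1, w s = ∫⁻ s, (Ioi τ).indicator w s ∂leb := by
      rw [lintegral_indicator measurableSet_Ioi, leb, Measure.restrict_restrict measurableSet_Ioi,
        inter_comm, Ioo_inter_Ioi, sup_eq_right.2 hτ.1.le]
    rw [hset]
    have hm := fun n => hw.indicator (hmeas n τ)
    refine ⟨fun m n hmn => lintegral_mono_ae (hmono.mono fun s hs => hs hmn),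
      lintegral_tendsto_of_tendsto_of_monotone hm hmono ?_⟩
    filter_upwards [ae_leb_mem] with s hs
    refine tendsto_const_nhds.congr' ?_
    by_cases hτs : τ < s
    · filter_upwards [eventually_lt_dyadicFloor hτs] with n hn
      rw [indicator_of_mem (show s ∈ Ioi τ from hτs),
        indicator_of_mem (show s ∈ {s | τ < dyadicFloor n s} from hn)]
    · refine Eventually.of_forall fun n => ?_
      have hn : s ∉ {s | τ < dyadicFloor n s} := fun hn =>
        hτs (lt_of_lt_of_le hn (dyadicFloor_le n hs.1.le))
      simp only [indicator_of_notMem (show s ∉ Ioi τ from hτs), indicator_of_notMem hn]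
  refine le_of_tendsto' (hY.fatou g _ (fun n => (hg n).aemeasurable) (Antitone.measurable
    fun τ τ' h => lintegral_mono_set (Ioo_subset_Ioo_left h)).aemeasurable
    (ae_leb_mem.mono hlim)).2 fun n => ?_
  have hfib : ∀ j : ℕ, MeasurableSet {s : ℝ | ⌊2 ^ n * s⌋₊ = j} := fun j =>
    (by fun_prop : Measurable fun s : ℝ => ⌊2 ^ n * s⌋₊) (measurableSet_singleton j)
  have hpart : ∀ F : ℝ → ℝ≥0∞, ∫⁻ s, F s ∂leb =
      ∑ j ∈ Finset.range (2 ^ n), ∫⁻ s in {s | ⌊2 ^ n * s⌋₊ = j}, F s ∂leb := fun F => by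
    rw [← lintegral_biUnion_finset (t := fun j : ℕ => {s : ℝ | ⌊2 ^ n * s⌋₊ = j})
      (fun i _ j _ hij => disjoint_left.2 fun s hs hs' => hij (Eq.trans (Eq.symm hs) hs'))
      fun j _ => hfib j, Measure.restrict_eq_self_of_ae_mem]
    filter_upwards [ae_leb_mem] with s hs
    simp only [mem_iUnion, Finset.mem_range, mem_ofPred_eq, exists_prop, exists_eq_right']
    rw [Nat.floor_lt (by have := hs.1; positivity)]
    push_cast
    nlinarith [hs.2, show (0 : ℝ) < 2 ^ n by positivity]
  let c : ℕ → ℝ≥0∞ := fun j => ∫⁻ s in {s | ⌊2 ^ n * s⌋₊ = j}, w s ∂leb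
  have hle : g n ≤ᵐ[leb] fun τ => ∑ j ∈ Finset.range (2 ^ n),
      c j * (Ioo (0 : ℝ) (j / 2 ^ n)).indicator (fun _ => 1) τ := by
    filter_upwards [ae_leb_mem] with τ hτ
    simp only [g, hpart]
    refine Finset.sum_le_sum fun j _ => ?_
    by_cases hj : τ < j / 2 ^ n
    · rw [indicator_of_mem (show τ ∈ Ioo _ _ from ⟨hτ.1, hj⟩), mul_one]
      exact lintegral_mono (indicator_le_self _ _)
    · refine (setLIntegral_congr_fun (hfib j) fun s hs => ?_).trans_le
        (lintegral_zero.le.trans zero_le)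
      refine indicator_of_notMem (fun hs' => hj ?_) _
      rw [← (show _ = j from hs)]
      exact hs'
  have hm := fun j : ℕ => (aemeasurable_indicator_Ioo 0 (j / 2 ^ n)).const_mul (c j)
  calc Y (g n) ≤ _ := hY.mono _ _ (hg n).aemeasurable
        (Finset.aemeasurable_fun_sum _ fun j _ => hm j) hle
    _ ≤ ∑ j ∈ Finset.range (2 ^ n), _ := hY.finset_sum_le _ hm
    _ = ∑ j ∈ Finset.range (2 ^ n), c j * fundamental Y (j / 2 ^ n) :=
        Finset.sum_congr rfl fun j _ => hY.const_mul (aemeasurable_indicator_Ioo _ _) _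
    _ ≤ ∑ j ∈ Finset.range (2 ^ n),
        ∫⁻ s in {s | ⌊2 ^ n * s⌋₊ = j}, fundamental Y s * w s ∂leb := by
        refine Finset.sum_le_sum fun j _ => ?_
        rw [mul_comm, ← lintegral_const_mul'' _ hw.restrict]
        refine lintegral_mono_ae ?_
        filter_upwards [ae_restrict_mem (hfib j), ae_restrict_of_ae ae_leb_mem] with s hs hs0
        gcongr
        refine hY.fundamental_mono ?_
        rw [← (show _ = j from hs)]
        exact dyadicFloor_le n hs0.1.le
    _ = _ := (hpart _).symm

/-- Among the functions with values in `[0,1]` and integral at most `t`, the indicator of `(0,t)`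
maximises the integral against a non-increasing weight. -/
lemma lintegral_mul_le_of_antitone {Ψ h : ℝ → ℝ≥0∞} (hΨ : Antitone Ψ) (hh : AEMeasurable h leb)
    (h1 : ∀ᵐ x ∂leb, h x ≤ 1) {t : ℝ} (ht : t ∈ Ioo (0 : ℝ) 1)
    (hint : ∫⁻ x, h x ∂leb ≤ ENNReal.ofReal t) :
    ∫⁻ x, h x * Ψ x ∂leb ≤ ∫⁻ x in Ioo 0 t, Ψ x := by
  have hle := restrict_Ioo_le_leb le_rfl ht.2.le
  have hsplit : ∀ F : ℝ → ℝ≥0∞, ∫⁻ x, F x ∂leb =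
      (∫⁻ x in Ioo 0 t, F x) + ∫⁻ x in Ico t 1, F x := fun F => by
    rw [leb, ← Ioo_union_Ico_eq_Ioo ht.1 ht.2.le, lintegral_union measurableSet_Ico]
    exact disjoint_left.2 fun x hx hx' => absurd hx.2 (not_lt.2 hx'.1)
  have hh' := hh.mono_measure hle
  have h1' : ∀ᵐ x ∂volume.restrict (Ioo 0 t), h x ≤ 1 := ae_mono hle h1
  have hcompl : (∫⁻ x in Ioo 0 t, h x) + ∫⁻ x in Ioo 0 t, (1 - h x) = ENNReal.ofReal t := by
    rw [← lintegral_add_left' hh']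
    calc _ = ∫⁻ _ in Ioo 0 t, 1 := lintegral_congr_ae (h1'.mono fun x hx =>
          add_tsub_cancel_of_le hx)
      _ = _ := by simp
  have htail : ∫⁻ x in Ico t 1, h x ≤ ∫⁻ x in Ioo 0 t, (1 - h x) := by
    rw [hsplit, ← hcompl] at hint
    refine (ENNReal.add_le_add_iff_left (ne_top_of_le_ne_top ENNReal.ofReal_ne_top
      (le_self_add.trans_eq hcompl))).1 hint
  have hIco : ∫⁻ x in Ico t 1, h x * Ψ x ≤ ∫⁻ x in Ioo 0 t, (1 - h x) * Ψ x :=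
    calc _ ≤ ∫⁻ x in Ico t 1, h x * Ψ t :=
          setLIntegral_mono_ae' measurableSet_Ico (ae_of_all _ fun x hx => by
            gcongr; exact hΨ hx.1)
      _ = (∫⁻ x in Ico t 1, h x) * Ψ t := lintegral_mul_const'' _ (hh.mono_measure
          (Measure.restrict_mono (Ico_subset_Ioo_left ht.1) le_rfl))
      _ ≤ (∫⁻ x in Ioo 0 t, (1 - h x)) * Ψ t := by gcongr
      _ = ∫⁻ x in Ioo 0 t, (1 - h x) * Ψ t :=
          (lintegral_mul_const'' _ (aemeasurable_const.sub hh')).symm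
      _ ≤ _ := setLIntegral_mono_ae' measurableSet_Ioo (ae_of_all _ fun x hx => by
            gcongr; exact hΨ hx.2.le)
  rw [hsplit]
  calc _ ≤ _ := add_le_add_right hIco _
    _ = ∫⁻ x in Ioo 0 t, (h x * Ψ x + (1 - h x) * Ψ x) :=
        (lintegral_add_left' (hh'.mul hΨ.measurable.aemeasurable) _).symm
    _ = _ := lintegral_congr_ae (h1'.mono fun x hx => by
        dsimp only
        rw [← add_mul, add_tsub_cancel_of_le hx, one_mul])

/-- At a continuity point of `I` the quotient `φ_Y / I` is the limit from the right of quotients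
that dominate it, so it does not exceed its supremum over points to the right. -/
lemma fundamental_div_le_iSup (hY : IsRINorm Y) (hI : MonotoneOn I (Icc (0 : ℝ) 1)) :
    ∀ᵐ s ∂leb, fundamental Y s / (I s : ℝ≥0∞) ≤
      ⨆ τ ∈ Ioo s 1, fundamental Y τ / (I τ : ℝ≥0∞) := by
  have hcont := ((hI.mono Ioo_subset_Icc_self).countable_not_continuousWithinAt).ae_notMem leb
  filter_upwards [ae_leb_mem, hcont] with s hs hcs
  have hc : ContinuousWithinAt I (Ioo 0 1) s := by
    by_contra h
    exact hcs ⟨hs, h⟩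
  have hc' : Tendsto I (𝓝[>] s) (𝓝 (I s)) :=
    (hc.continuousAt (Ioo_mem_nhds hs.1 hs.2)).tendsto.mono_left nhdsWithin_le_nhds
  have hlim : Tendsto (fun τ => fundamental Y s / (I τ : ℝ≥0∞)) (𝓝[>] s)
      (𝓝 (fundamental Y s / (I s : ℝ≥0∞))) :=
    ENNReal.Tendsto.const_div (ENNReal.tendsto_coe.2 hc') (Or.inl ENNReal.coe_ne_top)
  refine le_of_tendsto hlim ?_
  filter_upwards [Ioo_mem_nhdsGT hs.2] with τ hτ
  exact (ENNReal.div_le_div_right (hY.fundamental_mono hτ.1.le) _).trans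
    (le_iSup₂ (f := fun τ (_ : τ ∈ Ioo s 1) => fundamental Y τ / (I τ : ℝ≥0∞)) τ hτ)

/-- Minkowski's inequality bounds the norm of a Copson transform by a weighted integral, which is
largest when the mass of `h` sits at the left end of the interval. -/
lemma fundamental_inducedNorm_le (hY : IsRINorm Y) (hI : MonotoneOn I (Icc (0 : ℝ) 1)) {t : ℝ}
    (ht : t ∈ Ioo (0 : ℝ) 1) :
    fundamental (inducedNorm Y I) t ≤
      ∫⁻ s in Ioo 0 t, ⨆ τ ∈ Ioo s 1, fundamental Y τ / (I τ : ℝ≥0∞) := by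
  refine inducedNorm_le (aemeasurable_indicator_Ioo _ _) fun h H => ?_
  have hh := H.aemeasurable_fst
  have h1 : ∀ᵐ x ∂leb, h x ≤ 1 :=
    H.symm.ae_snd (p := fun y => y ≤ 1) measurableSet_Iic
      (ae_of_all _ fun x => indicator_le_self' (fun _ _ => zero_le) x)
  have hint : ∫⁻ x, h x ∂leb ≤ ENNReal.ofReal t := by
    rw [H.lintegral_eq, lintegral_indicator measurableSet_Ioo, setLIntegral_one]
    exact (Measure.restrict_apply_le _ _).trans_eq (by simp)
  have hanti : Antitone fun s => ⨆ τ ∈ Ioo s 1, fundamental Y τ / (I τ : ℝ≥0∞) :=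
    fun s s' hss => biSup_mono fun τ hτ => ⟨lt_of_le_of_lt hss hτ.1, hτ.2⟩
  calc Y (copson I h) ≤ ∫⁻ s, fundamental Y s * (h s / I s) ∂leb :=
        hY.minkowski (hh.div (aemeasurable_weight hI))
    _ ≤ ∫⁻ s, h s * ⨆ τ ∈ Ioo s 1, fundamental Y τ / (I τ : ℝ≥0∞) ∂leb := by
        refine lintegral_mono_ae ((fundamental_div_le_iSup hY hI).mono fun s hs => ?_)
        calc fundamental Y s * (h s / I s) = h s * (fundamental Y s / I s) := by
              simp only [div_eq_mul_inv]; ring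
          _ ≤ _ := by gcongr
    _ ≤ _ := lintegral_mul_le_of_antitone hanti hh h1 ht hint

end
end RI

theorem theorem3p1 (I : ℝ → ℝ≥0) (hI : MonotoneOn I (Icc (0 : ℝ) 1))
    (Y : (ℝ → ℝ≥0∞) → ℝ≥0∞) (hY : RI.IsRINorm Y)
    (hIY : Y (fun t => ∫⁻ s in Ioo t 1, 1 / (I s : ℝ≥0∞)) < ∞)
    (hφ : Tendsto (RI.fundamental Y) (𝓝[>] 0) (𝓝 0))
    (hcond : ∃ K : ℝ≥0, ∀ t ∈ Ioo (0 : ℝ) 1,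
      ∫⁻ s in Ioo 0 t, (⨆ τ ∈ Ioo s 1, RI.fundamental Y τ / (I τ : ℝ≥0∞)) ≤
        K * RI.profile (RI.fundamental Y) I t) :
    RI.IsRINorm (RI.inducedNorm Y I) ∧
      ∃ c C : ℝ≥0, 0 < c ∧ 0 < C ∧ ∀ t ∈ Ioo (0 : ℝ) 1,
        c * RI.profile (RI.fundamental Y) I t ≤ RI.fundamental (RI.inducedNorm Y I) t ∧
        RI.fundamental (RI.inducedNorm Y I) t ≤ C * RI.profile (RI.fundamental Y) I t := by
  refine ⟨RI.isRINorm_inducedNorm hY hI hIY, ?_⟩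
  obtain ⟨K, hK⟩ := hcond
  -- `K + 1` instead of `K`, since the constant has to be positive.
  refine ⟨1, K + 1, one_pos, by positivity, fun t ht => ⟨?_, ?_⟩⟩
  · rw [ENNReal.coe_one, one_mul]
    exact RI.profile_le_fundamental hY hI ht
  · refine ((RI.fundamental_inducedNorm_le hY hI ht).trans (hK t ht)).trans ?_
    gcongr
    exact le_self_add
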